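/- For $\sigma$-ideals $\mathcal I$ of subsets of $X$ and $\mathcal J$ of subsets of $Y$ ($X,Y$ Polish spaces), let the Fubini product $\mathcal I\otimes\mathcal J$ be the family of all $A\subseteq X\times Y$ for which there is a Borel set $B\subseteq X\times Y$ with $A\subseteq B$ and $\{x\in X: B_x\notin\mathcal J\}\in\mathcal I$, where $B_x=\{y:(x,y)\in B\}$. A set $U\subseteq\omega^\omega\times Z$ is called universal for a family $\mathcal K$ of subsets of $Z$ (here $\mathcal K$ is such a Fubini product) if its vertical sections form a base of $\mathcal K$, that is, $U_x\in\mathcal K$ for every $x\in\omega^\omega$, and for every $A\in\mathcal K$ there is $x\in\omega^\omega$ with $A\subseteq U_x$. Let $X$ be a Polish space and let $\mathcal M$ be the $\sigma$-ideal of meager subsets of $X$. Let $Y$ be either $\mathbb R$ with Lebesgue measure or $2^\omega$ with its Haar (fair coin-tossing product) measure, and let $\mathcal N$ be the $\sigma$-ideal of null subsets of $Y$. Then there is a $\Sigma^0_3$ set $U\subseteq\omega^\omega\times(X\times Y)$ that is universal for $\mathcal M\otimes\mathcal N$, and there is a $\Sigma^0_3$ set $V\subseteq\omega^\omega\times(Y\times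 X)$ that is universal for $\mathcal N\otimes\mathcal M$. In particular this holds with $X=Y=\mathbb R$ and with $X=Y=2^\omega$. -/

import Mathlib

open MeasureTheory Set

/-- The vertical section `B_x = {y : (x, y) ∈ B}`. -/
def vsection {X Y : Type*} (B : Set (X × Y)) (x : X) : Set Y :=
  {y | (x, y) ∈ B}

/-- `Σ⁰₃` sets, for metrizable spaces: the countable unions of `Π⁰₂` (that is, `G_δ`) sets. -/
def IsSigmaZeroThree {X : Type*} [TopologicalSpace X] (A : Set X) : Prop :=
  ∃ G : ℕ → Set X, (∀ n, IsGδ (G n)) ∧ A = ⋃ n, G n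

/-- `F` is a base of the ideal `I`: it is contained in `I` and cofinal in `I`. -/
def IsIdealBase {X : Type*} (F I : Set (Set X)) : Prop :=
  F ⊆ I ∧ ∀ A ∈ I, ∃ A' ∈ F, A ⊆ A'

/-- `U ⊆ ω^ω × X` is universal for the ideal `I`: its vertical sections form a base of `I`. -/
def IsUniversalForIdeal {X : Type*} (U : Set ((ℕ → ℕ) × X)) (I : Set (Set X)) : Prop :=
  IsIdealBase (range (vsection U)) I

/-- The Fubini product `I ⊗ J`: the sets contained in a Borel set `B ⊆ X × Y` such that
`{x : B_x ∉ J} ∈ I`. -/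
def fubiniProduct {X Y : Type*} [TopologicalSpace X] [TopologicalSpace Y]
    (I : Set (Set X)) (J : Set (Set Y)) : Set (Set (X × Y)) :=
  {A | ∃ B : Set (X × Y), MeasurableSet[borel (X × Y)] B ∧ A ⊆ B ∧ {x | vsection B x ∉ J} ∈ I}

/-- The `σ`-ideal of meager (first category) subsets of `X`. -/
def meagerIdeal (X : Type*) [TopologicalSpace X] : Set (Set X) :=
  {A | IsMeagre A}

/-- The `σ`-ideal of `μ`-null sets (sets of outer measure zero). -/
def nullIdeal {X : Type*} [MeasurableSpace X] (μ : Measure X) : Set (Set X) :=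
  {A | μ A = 0}

/-- The Haar probability measure on the Cantor group `2^ω`: the product of the uniform
measures on the two-point group. -/
noncomputable def cantorHaar : Measure (ℕ → Bool) :=
  Measure.infinitePi fun _ : ℕ => (PMF.uniformOfFintype Bool).toMeasure

/-! ### Coding families of open sets by points of the Baire space -/

section Codes

open TopologicalSpace

variable {Z : Type*} [TopologicalSpace Z]

/-! Both ideals have bases of sets of the form `F_σ ∪ G_δ` whose open ingredients can be coded
continuously by points of the Baire space; such a union is `Σ⁰₃`. For meager ⊗ null, the `F_σ` part
is (a union of closed nowhere dense sets) × `Y`, and the `G_δ` part is an intersection of open sets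
whose sections have measure at most `1/n` for residually many `x`. `exists_isOpen_squeeze` supplies
these open sets: a fiberwise outer regularity valid off a single meager set. For null ⊗ meager, the
`F_σ` part is the complement of an intersection of open sets with almost all sections dense, and the
`G_δ` part is (a null `G_δ`) × `X`. `exists_iUnion_prod_agree`, a fiberwise Baire property, reduces
Borel sets with meager sections to this shape. The codings come from two schemes: smallness
conditions are hereditary and pass to increasing unions; density conditions are upward closed and
are already met by finite unions of basic sets. Lebesgue measure is replaced by a finite measure
with the same null sets. -/

theorem exists_nat_basis (Z : Type*) [TopologicalSpace Z] [SecondCountableTopology Z] :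
    ∃ b : ℕ → Set Z, (∀ n, IsOpen (b n)) ∧ (∃ n, b n = ∅) ∧
      ∀ U, IsOpen U → ∀ z ∈ U, ∃ n, z ∈ b n ∧ b n ⊆ U := by
  obtain ⟨B, hc, -, hB⟩ := exists_countable_basis Z
  obtain ⟨b, hb⟩ := (hc.insert ∅).exists_eq_range (insert_nonempty _ _)
  refine ⟨b, fun n => ?_, ?_, fun U hU z hz => ?_⟩
  · rcases (hb ▸ mem_range_self n : b n ∈ insert ∅ B) with h | h
    · exact h ▸ isOpen_empty
    · exact hB.isOpen h
  · exact (hb ▸ mem_insert _ _ : ∅ ∈ range b)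
  · obtain ⟨v, hv, hzv, hvU⟩ := hB.exists_subset_of_mem_open hz hU
    obtain ⟨n, rfl⟩ := (hb ▸ mem_insert_of_mem _ hv : v ∈ range b)
    exact ⟨n, hzv, hvU⟩

/-- An open set whose vertical sections are exactly the open sets satisfying a hereditary property
that is preserved by increasing unions. -/
theorem exists_isOpen_vsection_of_hereditary [SecondCountableTopology Z] (P : Set Z → Prop)
    (hempty : P ∅) (hanti : ∀ s t, s ⊆ t → P t → P s)
    (hunion : ∀ s : ℕ → Set Z, Monotone s → (∀ n, P (s n)) → P (⋃ n, s n)) :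
    ∃ O : Set ((ℕ → ℕ) × Z), IsOpen O ∧ (∀ α, P (vsection O α)) ∧
      ∀ W, IsOpen W → P W → ∃ α, vsection O α = W := by
  obtain ⟨b, hbo, ⟨e, he⟩, hb⟩ := exists_nat_basis Z
  -- A basic set is admitted only while the union listed so far satisfies `P`. The test reads
  -- finitely many coordinates of the code, hence is clopen, and a bad code is cut off before `P`
  -- fails.
  refine ⟨⋃ n, {p | P (⋃ k : Fin (n + 1), b (p.1 k)) ∧ p.2 ∈ b (p.1 n)}, ?_, ?_, ?_⟩
  · refine isOpen_iUnion fun n => ?_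
    have h1 : IsOpen {p : (ℕ → ℕ) × Z | P (⋃ k : Fin (n + 1), b (p.1 k))} := by
      have hc : Continuous fun p : (ℕ → ℕ) × Z => fun k : Fin (n + 1) => p.1 k := by fun_prop
      exact (isOpen_discrete {f : Fin (n + 1) → ℕ | P (⋃ k, b (f k))}).preimage hc
    have h2 : IsOpen {p : (ℕ → ℕ) × Z | p.2 ∈ b (p.1 n)} := by
      have : {p : (ℕ → ℕ) × Z | p.2 ∈ b (p.1 n)} =
          ⋃ m, {p : (ℕ → ℕ) × Z | p.1 n = m} ∩ Prod.snd ⁻¹' b m := by ext; simp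
      rw [this]
      refine isOpen_iUnion fun m => IsOpen.inter ?_ ((hbo m).preimage continuous_snd)
      exact (isOpen_discrete {m}).preimage
        (by fun_prop : Continuous fun p : (ℕ → ℕ) × Z => p.1 n)
    exact h1.inter h2
  · intro α
    have key : ∀ N, P {z | ∃ n ≤ N, P (⋃ k : Fin (n + 1), b (α k)) ∧ z ∈ b (α n)} := by
      intro N
      induction N with
      | zero =>
        by_cases h : P (⋃ k : Fin (0 + 1), b (α k))
        · refine hanti _ _ ?_ h
          rintro z ⟨n, hn, -, hz⟩
          obtain rfl : n = 0 := by omega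
          exact mem_iUnion.2 ⟨0, by simpa using hz⟩
        · convert hempty
          ext z
          simp only [mem_ofPred_eq, mem_empty_iff_false, iff_false]
          rintro ⟨n, hn, h', -⟩
          obtain rfl : n = 0 := by omega
          exact h h'
      | succ N ih =>
        by_cases h : P (⋃ k : Fin (N + 1 + 1), b (α k))
        · refine hanti _ _ ?_ h
          rintro z ⟨n, hn, -, hz⟩
          exact mem_iUnion.2 ⟨⟨n, by omega⟩, hz⟩
        · refine hanti _ _ ?_ ih
          rintro z ⟨n, hn, h', hz⟩
          refine ⟨n, ?_, h', hz⟩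
          by_contra hlt
          obtain rfl : n = N + 1 := by omega
          exact h h'
    refine hanti _ _ ?_ (hunion _ ?_ key)
    · intro z hz
      obtain ⟨n, hn⟩ := mem_iUnion.1 hz
      exact mem_iUnion.2 ⟨n, n, le_rfl, hn⟩
    · rintro M N hMN z ⟨n, hn, h⟩
      exact ⟨n, hn.trans hMN, h⟩
  · intro W hW hPW
    -- The index of the empty basic set keeps the list of indices nonempty even when `W = ∅`.
    have hne : {k | b k ⊆ W}.Nonempty := ⟨e, by simp [he]⟩
    obtain ⟨α, hα⟩ := (to_countable {k | b k ⊆ W}).exists_eq_range hne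
    have hsub : ∀ n, b (α n) ⊆ W := fun n => (hα ▸ mem_range_self n : α n ∈ {k | b k ⊆ W})
    refine ⟨α, Subset.antisymm ?_ ?_⟩
    · intro z hz
      obtain ⟨n, -, hn⟩ := mem_iUnion.1 hz
      exact hsub n hn
    · intro z hz
      obtain ⟨k, hzk, hk⟩ := hb W hW z hz
      obtain ⟨n, rfl⟩ : k ∈ range α := hα ▸ hk
      exact mem_iUnion.2 ⟨n, hanti _ _ (iUnion_subset fun k => hsub k) hPW, hzk⟩

/-- An open set whose vertical sections are coinitial among the open sets satisfying countably many
upward closed properties, each of which holds for an increasing union only if it holds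
for one of its members. -/
theorem exists_isOpen_vsection_of_upwardClosed [SecondCountableTopology Z] {ι : Type*} [Countable ι]
    (P : ι → Set Z → Prop) (huniv : ∀ i, P i univ) (hmono : ∀ i s t, s ⊆ t → P i s → P i t)
    (hunion : ∀ i, ∀ s : ℕ → Set Z, Monotone s → (∀ n, IsOpen (s n)) → P i (⋃ n, s n) →
      ∃ n, P i (s n)) :
    ∃ O : Set ((ℕ → ℕ) × Z), IsOpen O ∧ (∀ α i, P i (vsection O α)) ∧
      ∀ W, IsOpen W → (∀ i, P i W) → ∃ α, vsection O α ⊆ W := by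
  classical
  obtain ⟨b, hbo, ⟨e, he⟩, hb⟩ := exists_nat_basis Z
  obtain ⟨c, hc⟩ := exists_injective_nat ι
  obtain ⟨F, hF⟩ := exists_surjective_nat (Finset ℕ)
  -- Coordinate `c i` names a finite union of basic sets meant to witness `P i`; a name that fails
  -- is read as the whole space, so every code is valid.
  let T : ι → ℕ → Set Z := fun i m =>
    if P i (⋃ j ∈ F m, b j) then ⋃ j ∈ F m, b j else univ
  have hTo : ∀ i m, IsOpen (T i m) := by
    intro i m
    by_cases h : P i (⋃ j ∈ F m, b j)
    · simp only [T, if_pos h]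
      exact isOpen_biUnion fun j _ => hbo j
    · simp only [T, if_neg h, isOpen_univ]
  have hTP : ∀ i m, P i (T i m) := by
    intro i m
    by_cases h : P i (⋃ j ∈ F m, b j)
    · simpa only [T, if_pos h] using h
    · simpa only [T, if_neg h] using huniv i
  refine ⟨⋃ i, ⋃ m, {p | p.1 (c i) = m} ∩ Prod.snd ⁻¹' T i m, ?_, ?_, ?_⟩
  · refine isOpen_iUnion fun i => isOpen_iUnion fun m =>
      IsOpen.inter ?_ ((hTo i m).preimage continuous_snd)
    exact (isOpen_discrete {m}).preimage
      (by fun_prop : Continuous fun p : (ℕ → ℕ) × Z => p.1 (c i))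
  · intro α i
    refine hmono i _ _ ?_ (hTP i (α (c i)))
    intro z hz
    exact mem_iUnion.2 ⟨i, mem_iUnion.2 ⟨_, rfl, hz⟩⟩
  · intro W hW hPW
    have hfin : ∀ i, ∃ m, P i (⋃ j ∈ F m, b j) ∧ ⋃ j ∈ F m, b j ⊆ W := by
      intro i
      let s : ℕ → Set Z := fun n => ⋃ j ∈ (Finset.range n).filter fun j => b j ⊆ W, b j
      have hs : ⋃ n, s n = W := by
        refine Subset.antisymm (iUnion_subset fun n => iUnion₂_subset fun j hj => ?_) ?_
        · exact (Finset.mem_filter.1 hj).2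
        · intro z hz
          obtain ⟨k, hzk, hk⟩ := hb W hW z hz
          exact mem_iUnion.2 ⟨k + 1, mem_iUnion₂.2 ⟨k, by simp [hk], hzk⟩⟩
      obtain ⟨n, hn⟩ := hunion i s
        (fun m n hmn => biUnion_subset_biUnion_left fun j hj => by
          simp only [Finset.coe_filter, Finset.mem_range, mem_ofPred_eq] at hj ⊢
          exact ⟨hj.1.trans_le hmn, hj.2⟩)
        (fun n => isOpen_biUnion fun j _ => hbo j) (hs ▸ hPW i)
      obtain ⟨m, hm⟩ := hF ((Finset.range n).filter fun j => b j ⊆ W)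
      refine ⟨m, hm ▸ hn, ?_⟩
      rw [hm]
      exact (subset_iUnion s n).trans hs.subset
    choose m hm using hfin
    refine ⟨fun k => if h : ∃ i, c i = k then m h.choose else 0, ?_⟩
    intro z hz
    obtain ⟨i, hz⟩ := mem_iUnion.1 hz
    obtain ⟨k, hk, hz⟩ := mem_iUnion.1 hz
    have hex : ∃ i', c i' = c i := ⟨i, rfl⟩
    have hk' : m i = k := by
      rw [← show (if h : ∃ i', c i' = c i then m h.choose else 0) = k from hk, dif_pos hex,
        hc hex.choose_spec]
    subst hk'
    refine (hm i).2 ?_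
    simpa only [mem_preimage, T, if_pos (hm i).1] using hz

/-- The sequence of points of the Baire space coded by one point. -/
def baireSlice (α : ℕ → ℕ) (n : ℕ) : ℕ → ℕ := fun k => α (Nat.pair n k)

theorem continuous_baireSlice (n : ℕ) : Continuous fun α : ℕ → ℕ => baireSlice α n := by
  unfold baireSlice; fun_prop

theorem exists_baireSlice_eq (β : ℕ → ℕ → ℕ) : ∃ α, ∀ n, baireSlice α n = β n :=
  ⟨fun k => β k.unpair.1 k.unpair.2, fun n => by funext k; simp [baireSlice]⟩

variable {Z₁ Z₂ : Type*} [TopologicalSpace Z₁] [TopologicalSpace Z₂]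

/-- The union of an `F_σ` set with a `G_δ` set, given by sequences of codes. -/
def codedUnion (O : Set ((ℕ → ℕ) × Z₁)) (W : ℕ → Set ((ℕ → ℕ) × Z₂)) (p : Z → Z₁) (q : Z → Z₂) :
    Set ((ℕ → ℕ) × Z) :=
  {a | (∃ n, (baireSlice a.1 (2 * n), p a.2) ∉ O) ∨
    ∀ n, (baireSlice a.1 (2 * n + 1), q a.2) ∈ W n}

theorem isSigmaZeroThree_codedUnion [MetrizableSpace Z] {O : Set ((ℕ → ℕ) × Z₁)} (hO : IsOpen O)
    {W : ℕ → Set ((ℕ → ℕ) × Z₂)} (hW : ∀ n, IsOpen (W n)) {p : Z → Z₁} (hp : Continuous p)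
    {q : Z → Z₂} (hq : Continuous q) : IsSigmaZeroThree (codedUnion O W p q) := by
  let _ := metrizableSpaceMetric ((ℕ → ℕ) × Z)
  refine ⟨fun n => Nat.casesOn n
    (⋂ n, (fun a : (ℕ → ℕ) × Z => (baireSlice a.1 (2 * n + 1), q a.2)) ⁻¹' W n)
    fun n => ((fun a : (ℕ → ℕ) × Z => (baireSlice a.1 (2 * n), p a.2)) ⁻¹' O)ᶜ, ?_, ?_⟩
  · rintro (_ | n)
    · exact IsGδ.iInter_of_isOpen fun n => (hW n).preimage
        (((continuous_baireSlice _).comp continuous_fst).prodMk (hq.comp continuous_snd))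
    · exact (hO.preimage (((continuous_baireSlice _).comp continuous_fst).prodMk
        (hp.comp continuous_snd))).isClosed_compl.isGδ
  · ext a
    simp only [codedUnion, mem_ofPred_eq, mem_iUnion]
    constructor
    · rintro (⟨n, hn⟩ | h)
      · exact ⟨n + 1, hn⟩
      · exact ⟨0, mem_iInter.2 h⟩
    · rintro ⟨_ | n, h⟩
      · exact Or.inr (mem_iInter.1 h)
      · exact Or.inl ⟨n, h⟩

theorem IsSigmaZeroThree.measurableSet_vsection {U : Set ((ℕ → ℕ) × Z)} (hU : IsSigmaZeroThree U)
    (α : ℕ → ℕ) : MeasurableSet[borel Z] (vsection U α) := by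
  borelize Z
  borelize ((ℕ → ℕ) × Z)
  obtain ⟨G, hG, rfl⟩ := hU
  exact (MeasurableSet.iUnion fun n => (hG n).measurableSet).preimage
    (Continuous.prodMk_right α).measurable

end Codes

/-! ### Meager sets times null sets -/

section MeagerNull

open Filter TopologicalSpace

open scoped ENNReal Topology

variable {X Y : Type*} [TopologicalSpace X] [MeasurableSpace X]
  [BorelSpace X] [TopologicalSpace Y] [SecondCountableTopology Y] [MeasurableSpace Y] [BorelSpace Y]

/-- The index `n` that works depends on `x`, but the set of `x` for which a given `n` works is
Borel, so it is open modulo a meager set. Gluing `V n` over these open sets gives `V'`. -/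
theorem exists_isOpen_measure_section_le (μ : Measure Y) [SFinite μ] {ε : ℝ≥0∞}
    {W : Set (X × Y)} (hW : IsOpen W) {V : ℕ → Set (X × Y)} (hV : ∀ n, IsOpen (V n))
    (hanti : Antitone V) (h : ∀ᶠ x in residual X, ∃ n, μ (Prod.mk x ⁻¹' (W ∩ V n)) ≤ ε) :
    ∃ V', IsOpen V' ∧ ∀ᶠ x in residual X,
      Prod.mk x ⁻¹' (⋂ n, V n) ⊆ Prod.mk x ⁻¹' V' ∧ μ (Prod.mk x ⁻¹' (W ∩ V')) ≤ ε := by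
  classical
  have hE : ∀ n, MeasurableSet {x | μ (Prod.mk x ⁻¹' (W ∩ V n)) ≤ ε} := fun n =>
    measurable_measure_prodMk_left (hW.inter (hV n)).measurableSet measurableSet_Iic
  choose O hO hEO using fun n => (hE n).residualEq_isOpen
  refine ⟨⋃ n, Prod.fst ⁻¹' O n ∩ V n,
    isOpen_iUnion fun n => ((hO n).preimage continuous_fst).inter (hV n), ?_⟩
  have hEO' : ∀ᶠ x in residual X, ∀ n, μ (Prod.mk x ⁻¹' (W ∩ V n)) ≤ ε ↔ x ∈ O n :=
    eventually_countable_forall.2 fun n => (hEO n).mem_iff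
  filter_upwards [hEO', h] with x hx hex
  have hex' : ∃ n, x ∈ O n := hex.imp fun n hn => (hx n).1 hn
  refine ⟨fun y hy => ?_, ?_⟩
  · obtain ⟨n, hn⟩ := hex'
    exact mem_iUnion.2 ⟨n, hn, mem_iInter.1 hy n⟩
  -- As `V` decreases, the section of `V'` at `x` lies in that of `V n` for the least admissible
  -- `n`.
  · refine (measure_mono ?_).trans ((hx _).2 (Nat.find_spec hex'))
    rintro y ⟨hyW, hy⟩
    obtain ⟨n, hn, hyn⟩ := mem_iUnion.1 hy
    exact ⟨hyW, hanti (Nat.find_min' hex' hn) hyn⟩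

/-- For residually many sections, a Borel set is squeezed between a closed set (the complement
of `V`) and an open set `W` whose difference is uniformly small. -/
theorem exists_isOpen_squeeze [SecondCountableTopology X] [MetrizableSpace X] [MetrizableSpace Y]
    (μ : Measure Y) [IsFiniteMeasure μ] {B : Set (X × Y)} (hB : MeasurableSet B) {ε : ℝ≥0∞} (hε : ε ≠ 0) :
    ∃ W V : Set (X × Y), IsOpen W ∧ IsOpen V ∧ ∀ᶠ x in residual X,
      Prod.mk x ⁻¹' B ⊆ Prod.mk x ⁻¹' W ∧ Prod.mk x ⁻¹' Bᶜ ⊆ Prod.mk x ⁻¹' V ∧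
      μ (Prod.mk x ⁻¹' (W ∩ V)) ≤ ε := by
  induction B, hB using MeasurableSet.induction_on_open generalizing ε with
  | isOpen B hB =>
    let _ := metrizableSpaceMetric (X × Y)
    obtain ⟨F, hFc, hFB, hF, hmono⟩ := hB.exists_iUnion_isClosed
    have hanti : Antitone fun n => (F n)ᶜ := fun m n h => compl_subset_compl.2 (hmono h)
    obtain ⟨V, hV, h⟩ := exists_isOpen_measure_section_le μ (ε := ε) hB
      (fun n => (hFc n).isOpen_compl) hanti (Eventually.of_forall fun x => by
        have ht := tendsto_measure_iInter_atTop (μ := μ)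
          (s := fun n => Prod.mk x ⁻¹' (B ∩ (F n)ᶜ))
          (fun n => ((hB.inter (hFc n).isOpen_compl).measurableSet.preimage
            measurable_prodMk_left).nullMeasurableSet)
          (fun m n h => preimage_mono (inter_subset_inter_right _ (hanti h)))
          ⟨0, measure_ne_top _ _⟩
        have h0 : ⋂ n, Prod.mk x ⁻¹' (B ∩ (F n)ᶜ) = ∅ := by
          refine eq_empty_of_forall_notMem fun y hy => ?_
          have hyB : (x, y) ∈ B := (mem_iInter.1 hy 0).1
          rw [← hF] at hyB
          obtain ⟨n, hn⟩ := mem_iUnion.1 hyB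
          exact (mem_iInter.1 hy n).2 hn
        rw [h0, measure_empty] at ht
        exact (ht.eventually (gt_mem_nhds (pos_iff_ne_zero.2 hε))).exists.imp fun n => le_of_lt)
    refine ⟨B, V, hB, hV, h.mono fun x hx => ⟨Subset.rfl, ?_, hx.2⟩⟩
    rw [← compl_iUnion, hF] at hx
    exact hx.1
  | compl B _ ih =>
    obtain ⟨W, V, hW, hV, h⟩ := ih hε
    refine ⟨V, W, hV, hW, h.mono fun x hx => ⟨hx.2.1, ?_, ?_⟩⟩
    · rw [compl_compl]; exact hx.1
    · rw [inter_comm]; exact hx.2.2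
  | iUnion B _ _ ih =>
    -- Half of `ε` pays for the sets `W n ∩ V n`. Since `⋂ n, V n` need not be open, finite
    -- intersections replace it; the other half pays for the part of `⋃ n, W n` outside the first
    -- `N` sets, with `N` depending on `x`.
    obtain ⟨δ, hδ, hsum⟩ := ENNReal.exists_pos_sum_of_countable' (ENNReal.half_pos hε).ne' ℕ
    choose W V hW hV h using fun n => ih n (hδ n).ne'
    have hWo : IsOpen (⋃ n, W n) := isOpen_iUnion hW
    have hVo : ∀ N, IsOpen (⋂ n ∈ Finset.range N, V n) := fun N =>
      isOpen_biInter_finset fun n _ => hV n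
    have hanti : Antitone fun N => ⋂ n ∈ Finset.range N, V n := fun M N hMN =>
      biInter_subset_biInter_left fun n hn => by
        simp only [Finset.coe_range, mem_Iio] at hn ⊢
        exact hn.trans_le hMN
    have h' := eventually_countable_forall.2 h
    obtain ⟨V', hV', h''⟩ := exists_isOpen_measure_section_le μ (ε := ε) hWo hVo hanti
      (h'.mono fun x hx => by
        let R : ℕ → Set Y := fun N => Prod.mk x ⁻¹' ((⋃ n, W n) \ ⋃ n ∈ Finset.range N, W n)
        have ht := tendsto_measure_iInter_atTop (μ := μ) (s := R)
          (fun N => ((hWo.measurableSet.diff (isOpen_biUnion fun n _ => hW n).measurableSet).preimage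
            measurable_prodMk_left).nullMeasurableSet)
          (fun M N hMN => preimage_mono (sdiff_subset_sdiff_right
            (biUnion_subset_biUnion_left fun n hn => by
              simp only [Finset.coe_range, mem_Iio] at hn ⊢
              exact hn.trans_le hMN)))
          ⟨0, measure_ne_top _ _⟩
        have h0 : ⋂ N, R N = ∅ := by
          refine eq_empty_of_forall_notMem fun y hy => ?_
          obtain ⟨n, hn⟩ := mem_iUnion.1 (mem_iInter.1 hy 0).1
          exact (mem_iInter.1 hy (n + 1)).2 (mem_iUnion₂.2 ⟨n, by simp, hn⟩)
        rw [h0, measure_empty] at ht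
        obtain ⟨N, hN⟩ := (ht.eventually (gt_mem_nhds (ENNReal.half_pos hε))).exists
        refine ⟨N, ?_⟩
        have hsub : Prod.mk x ⁻¹' ((⋃ n, W n) ∩ ⋂ n ∈ Finset.range N, V n) ⊆
            R N ∪ ⋃ n, Prod.mk x ⁻¹' (W n ∩ V n) := by
          rintro y ⟨hyW, hyV⟩
          by_cases hy : (x, y) ∈ ⋃ n ∈ Finset.range N, W n
          · obtain ⟨n, hn, hyn⟩ := mem_iUnion₂.1 hy
            exact Or.inr (mem_iUnion.2 ⟨n, hyn, mem_iInter₂.1 hyV n hn⟩)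
          · exact Or.inl ⟨hyW, hy⟩
        calc _ ≤ μ (R N ∪ ⋃ n, Prod.mk x ⁻¹' (W n ∩ V n)) := measure_mono hsub
          _ ≤ μ (R N) + ∑' n, μ (Prod.mk x ⁻¹' (W n ∩ V n)) :=
            (measure_union_le _ _).trans (add_le_add_right (measure_iUnion_le _) _)
          _ ≤ ε / 2 + ε / 2 := add_le_add (le_of_lt hN)
            ((ENNReal.tsum_le_tsum fun n => (hx n).2.2).trans hsum.le)
          _ = ε := ENNReal.add_halves ε)
    refine ⟨⋃ n, W n, V', hWo, hV', ?_⟩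
    filter_upwards [h', h''] with x hx hx'
    refine ⟨fun y hy => ?_, fun y hy => hx'.1 ?_, hx'.2⟩
    · obtain ⟨n, hn⟩ := mem_iUnion.1 hy
      exact mem_iUnion.2 ⟨n, (hx n).1 hn⟩
    · exact mem_iInter.2 fun N => mem_iInter₂.2 fun n _ =>
        (hx n).2.1 fun hyn => hy (mem_iUnion.2 ⟨n, hyn⟩)

theorem exists_seq_isOpen_dense_of_mem_residual {X : Type*} [TopologicalSpace X] {s : Set X} (hs : s ∈ residual X) :
    ∃ D : ℕ → Set X, (∀ n, IsOpen (D n)) ∧ (∀ n, Dense (D n)) ∧ ⋂ n, D n ⊆ s := by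
  obtain ⟨S, hSo, hSd, hSc, hS⟩ := mem_residual_iff.1 hs
  -- Adding `univ` allows an enumeration even if the family is empty.
  obtain ⟨D, hD⟩ := (hSc.insert univ).exists_eq_range (insert_nonempty _ _)
  have hmem : ∀ n, D n ∈ insert univ S := fun n => hD ▸ mem_range_self n
  refine ⟨D, fun n => ?_, fun n => ?_, fun x hx => hS ?_⟩
  · rcases hmem n with h | h
    · exact h ▸ isOpen_univ
    · exact hSo _ h
  · rcases hmem n with h | h
    · exact h ▸ dense_univ
    · exact hSd _ h
  · rintro t ht
    obtain ⟨n, rfl⟩ : t ∈ range D := hD ▸ mem_insert_of_mem _ ht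
    exact mem_iInter.1 hx n

/-- An open set whose vertical sections are dense and coinitial among the dense open sets. -/
theorem exists_isOpen_vsection_dense (X : Type*) [TopologicalSpace X] [SecondCountableTopology X] :
    ∃ O : Set ((ℕ → ℕ) × X), IsOpen O ∧ (∀ α, Dense (vsection O α)) ∧
      ∀ W, IsOpen W → Dense W → ∃ α, vsection O α ⊆ W := by
  obtain ⟨b, hbo, -, hb⟩ := exists_nat_basis X
  obtain ⟨O, hO, hP, h⟩ := exists_isOpen_vsection_of_upwardClosed
    (fun i s => (b i).Nonempty → (b i ∩ s).Nonempty) (fun i hi => by simpa using hi)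
    (fun i s t hst hs hi => (hs hi).mono (inter_subset_inter_right _ hst))
    (fun i s _ _ hs => by
      by_cases hi : (b i).Nonempty
      · obtain ⟨x, hxi, hx⟩ := hs hi
        obtain ⟨n, hn⟩ := mem_iUnion.1 hx
        exact ⟨n, fun _ => ⟨x, hxi, hn⟩⟩
      · exact ⟨0, fun h => absurd h hi⟩)
  refine ⟨O, hO, fun α => dense_iff_inter_open.2 fun U hU ⟨x, hx⟩ => ?_,
    fun W hW hd => h W hW fun i hi => hd.inter_open_nonempty _ (hbo i) hi⟩
  obtain ⟨i, hxi, hi⟩ := hb U hU x hx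
  exact (hP α i ⟨x, hxi⟩).mono (inter_subset_inter_left _ hi)

theorem exists_universal_meager_null (X : Type*) [TopologicalSpace X] [PolishSpace X] {Y : Type*}
    [TopologicalSpace Y] [MetrizableSpace Y] [SecondCountableTopology Y] [MeasurableSpace Y]
    [BorelSpace Y] (μ : Measure Y) [IsFiniteMeasure μ] :
    ∃ U : Set ((ℕ → ℕ) × (X × Y)), IsSigmaZeroThree U ∧
      IsUniversalForIdeal U (fubiniProduct (meagerIdeal X) (nullIdeal μ)) := by
  borelize X
  obtain ⟨O, hO, hOd, hOc⟩ := exists_isOpen_vsection_dense X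
  choose W hW hWμ hWc using fun n : ℕ => exists_isOpen_vsection_of_hereditary
    (fun s : Set (X × Y) => ∀ᶠ x in residual X, μ (Prod.mk x ⁻¹' s) ≤ (n : ℝ≥0∞)⁻¹) (by simp)
    (fun s t hst ht => ht.mono fun x hx => (measure_mono (preimage_mono hst)).trans hx)
    (fun s hs h => (eventually_countable_forall.2 h).mono fun x hx => by
      rw [preimage_iUnion]
      exact le_of_tendsto' (tendsto_measure_iUnion_atTop fun m n hmn => preimage_mono (hs hmn)) hx)
  have hU := isSigmaZeroThree_codedUnion (Z := X × Y) hO hW continuous_fst continuous_id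
  refine ⟨_, hU, ?_, ?_⟩
  · rintro _ ⟨α, rfl⟩
    refine ⟨_, hU.measurableSet_vsection α, Subset.rfl, ?_⟩
    have h1 : ∀ᶠ x in residual X, ∀ n, x ∈ vsection O (baireSlice α (2 * n)) :=
      eventually_countable_forall.2 fun n => residual_of_dense_open
        (hO.preimage (Continuous.prodMk_right _)) (hOd _)
    have h2 := eventually_countable_forall.2 fun n => hWμ n (baireSlice α (2 * n + 1))
    change _ ∈ residual X
    filter_upwards [h1, h2] with x hx1 hx2
    simp only [mem_compl_iff, mem_ofPred_eq, not_not]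
    refine le_antisymm (ge_of_tendsto' ENNReal.tendsto_inv_nat_nhds_zero fun n =>
      (measure_mono ?_).trans (hx2 n)) zero_le
    rintro y (⟨m, hm⟩ | hy)
    · exact absurd (hx1 m) hm
    · exact hy n
  · rintro A ⟨B, hB, hAB, hBm⟩
    have hB' : MeasurableSet B := by rwa [BorelSpace.measurable_eq (α := X × Y)]
    have hBm' : ∀ᶠ x in residual X, μ (Prod.mk x ⁻¹' B) = 0 := by
      filter_upwards [show _ ∈ residual X from hBm] with x hx
      exact not_not.1 hx
    choose G V hG hV hGV using fun n : ℕ => exists_isOpen_squeeze μ hB'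
      (ε := (n : ℝ≥0∞)⁻¹) (by simp)
    obtain ⟨D, hDo, hDd, hD⟩ := exists_seq_isOpen_dense_of_mem_residual
      (eventually_countable_forall.2 hGV)
    choose γ hγ using fun n => hOc (D n) (hDo n) (hDd n)
    -- Where the section of `B` is null, `G n` exceeds it only inside `G n ∩ V n`. For `n = 0` the
    -- bound is `∞`, hence harmless.
    choose δ hδ using fun n => hWc n (G n) (hG n) (by
      filter_upwards [hGV n, hBm'] with x hx hx0
      calc μ (Prod.mk x ⁻¹' G n)
          ≤ μ (Prod.mk x ⁻¹' B ∪ Prod.mk x ⁻¹' (G n ∩ V n)) := measure_mono fun y hy => by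
            by_cases hyB : (x, y) ∈ B
            · exact Or.inl hyB
            · exact Or.inr ⟨hy, hx.2.1 hyB⟩
        _ ≤ 0 + (n : ℝ≥0∞)⁻¹ := (measure_union_le _ _).trans (add_le_add hx0.le hx.2.2)
        _ = _ := zero_add _)
    obtain ⟨α, hα⟩ := exists_baireSlice_eq fun k => if k % 2 = 0 then γ (k / 2) else δ (k / 2)
    have hα0 : ∀ n, baireSlice α (2 * n) = γ n := fun n => by simp [hα]
    have hα1 : ∀ n, baireSlice α (2 * n + 1) = δ n := fun n => by
      rw [hα, if_neg (by omega), show (2 * n + 1) / 2 = n by omega]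
    refine ⟨_, ⟨α, rfl⟩, ?_⟩
    rintro ⟨x, y⟩ hxy
    by_cases hx : ∀ n, x ∈ D n
    · refine Or.inr fun n => ?_
      rw [hα1]
      change (x, y) ∈ vsection (W n) (δ n)
      rw [hδ n]
      exact (hD (mem_iInter.2 hx) n).1 (hAB hxy)
    · push Not at hx
      obtain ⟨n, hn⟩ := hx
      refine Or.inl ⟨n, fun h => hn (hγ n ?_)⟩
      rw [hα0] at h
      exact h

end MeagerNull

/-! ### Null sets times meager sets -/

section NullMeager

open Filter TopologicalSpace

open scoped ENNReal Topology

variable {X Y : Type*} [TopologicalSpace X] [TopologicalSpace Y] [MeasurableSpace Y]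

/-- `G` contains, in almost all vertical sections, the intersection of a sequence of open sets
almost all of whose vertical sections are dense. -/
def IsAEComeager (μ : Measure Y) (G : Set (Y × X)) : Prop :=
  ∃ D : ℕ → Set (Y × X), (∀ n, IsOpen (D n)) ∧ (∀ n, ∀ᵐ y ∂μ, Dense (Prod.mk y ⁻¹' D n)) ∧
    ∀ᵐ y ∂μ, Prod.mk y ⁻¹' (⋂ n, D n) ⊆ Prod.mk y ⁻¹' G

namespace IsAEComeager

variable {μ : Measure Y} {G H : Set (Y × X)}

theorem mono_ae (hG : IsAEComeager μ G) (h : ∀ᵐ y ∂μ, Prod.mk y ⁻¹' G ⊆ Prod.mk y ⁻¹' H) :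
    IsAEComeager μ H := by
  obtain ⟨D, hDo, hDd, hD⟩ := hG
  refine ⟨D, hDo, hDd, ?_⟩
  filter_upwards [hD, h] with y h1 h2 using h1.trans h2

theorem mono (hG : IsAEComeager μ G) (h : G ⊆ H) : IsAEComeager μ H :=
  hG.mono_ae (Eventually.of_forall fun _ => preimage_mono h)

theorem univ : IsAEComeager μ (univ : Set (Y × X)) :=
  ⟨fun _ => Set.univ, fun _ => isOpen_univ, fun _ => by simp [dense_univ], by simp⟩

theorem iInter {G : ℕ → Set (Y × X)} (hG : ∀ n, IsAEComeager μ (G n)) :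
    IsAEComeager μ (⋂ n, G n) := by
  choose D hDo hDd hD using hG
  refine ⟨fun k => D k.unpair.1 k.unpair.2, fun k => hDo _ _, fun k => hDd _ _, ?_⟩
  filter_upwards [eventually_countable_forall.2 hD] with y hy x hx
  refine mem_iInter.2 fun n => hy n (mem_iInter.2 fun m => ?_)
  simpa using mem_iInter.1 hx (Nat.pair n m)

theorem inter (hG : IsAEComeager μ G) (hH : IsAEComeager μ H) : IsAEComeager μ (G ∩ H) :=
  (iInter (G := fun n => Nat.casesOn n G fun _ => H) (by rintro (_ | n) <;> assumption)).mono
    fun _ hx => ⟨mem_iInter.1 hx 0, mem_iInter.1 hx 1⟩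

/-- A countable union of measurable-by-open rectangles with dense vertical sections can be
approximated by open sets. -/
theorem of_dense_section [μ.OuterRegular] [IsFiniteMeasure μ] {b : ℕ → Set X}
    (hb : ∀ i, IsOpen (b i)) {E : ℕ → Set Y} (hE : ∀ i, MeasurableSet (E i))
    (hd : ∀ y, Dense {x | ∃ i, y ∈ E i ∧ x ∈ b i}) :
    IsAEComeager μ {p : Y × X | ∃ i, p.1 ∈ E i ∧ p.2 ∈ b i} := by
  -- Each `E i` is enlarged to an open set with total excess at most `1/n`. A point `y` outside the
  -- excess for some `n` gains nothing there, and the points in the excess for all `n` form a null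
  -- set.
  have key : ∀ n : ℕ, ∃ E' : ℕ → Set Y, (∀ i, E i ⊆ E' i) ∧ (∀ i, IsOpen (E' i)) ∧
      μ (⋃ i, E' i \ E i) ≤ (n : ℝ≥0∞)⁻¹ := by
    intro n
    obtain ⟨δ, hδ, hsum⟩ := ENNReal.exists_pos_sum_of_countable'
      (ENNReal.inv_ne_zero.2 (ENNReal.natCast_ne_top n)) ℕ
    choose E' hEE' ho _ hE' using fun i => (hE i).exists_isOpen_sdiff_lt (μ := μ)
      (measure_ne_top _ _) (hδ i).ne'
    exact ⟨E', hEE', ho, (measure_iUnion_le _).trans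
      ((ENNReal.tsum_le_tsum fun i => (hE' i).le).trans hsum.le)⟩
  choose E' hEE' ho hE' using key
  refine ⟨fun n => ⋃ i, E' n i ×ˢ b i, fun n => isOpen_iUnion fun i => (ho n i).prod (hb i),
    fun n => Eventually.of_forall fun y => (hd y).mono ?_, ?_⟩
  · rintro x ⟨i, hy, hx⟩
    exact mem_iUnion.2 ⟨i, hEE' n i hy, hx⟩
  · have hnull : μ (⋂ n, ⋃ i, E' n i \ E i) = 0 :=
      le_antisymm (ge_of_tendsto' ENNReal.tendsto_inv_nat_nhds_zero fun n =>
        (measure_mono (iInter_subset _ n)).trans (hE' n)) zero_le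
    filter_upwards [measure_eq_zero_iff_ae_notMem.1 hnull] with y hy x hx
    rw [mem_iInter, not_forall] at hy
    obtain ⟨n, hn⟩ := hy
    obtain ⟨i, hyi, hxi⟩ := mem_iUnion.1 (mem_iInter.1 hx n)
    refine ⟨i, ?_, hxi⟩
    by_contra h
    exact hn (mem_iUnion.2 ⟨i, hyi, h⟩)

theorem ae_section_mem_residual (hG : IsAEComeager μ G) :
    ∀ᵐ y ∂μ, Prod.mk y ⁻¹' G ∈ residual X := by
  obtain ⟨D, hDo, hDd, hD⟩ := hG
  filter_upwards [hD, eventually_countable_forall.2 hDd] with y hy hyd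
  refine mem_of_superset ?_ hy
  rw [preimage_iInter]
  exact countable_iInter_mem.2 fun n =>
    residual_of_dense_open ((hDo n).preimage (Continuous.prodMk_right y)) (hyd n)

end IsAEComeager

/-- A Borel set agrees on an almost everywhere comeager set with a countable union of
measurable-by-open rectangles. -/
theorem exists_iUnion_prod_agree [SecondCountableTopology X] [SecondCountableTopology Y]
    [BorelSpace Y] [MeasurableSpace X] [BorelSpace X] (μ : Measure Y) [μ.OuterRegular]
    [IsFiniteMeasure μ] {b : ℕ → Set X} (hbo : ∀ i, IsOpen (b i))
    (hb : ∀ U, IsOpen U → ∀ x ∈ U, ∃ i, x ∈ b i ∧ b i ⊆ U) {B : Set (Y × X)}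
    (hB : MeasurableSet B) :
    ∃ E : ℕ → Set Y, (∀ i, MeasurableSet (E i)) ∧
      IsAEComeager μ {p | p ∈ B ↔ ∃ i, p.1 ∈ E i ∧ p.2 ∈ b i} := by
  induction B, hB using MeasurableSet.induction_on_open with
  | isOpen B hB =>
    refine ⟨fun i => ⋃₀ {V | IsOpen V ∧ V ×ˢ b i ⊆ B},
      fun i => (isOpen_sUnion fun V hV => hV.1).measurableSet, ?_⟩
    refine IsAEComeager.univ.mono ?_
    rintro ⟨y, x⟩ -
    constructor
    · intro h
      obtain ⟨V, U, hV, hU, hy, hx, hVU⟩ := isOpen_prod_iff.1 hB y x h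
      obtain ⟨i, hxi, hi⟩ := hb U hU x hx
      exact ⟨i, ⟨V, ⟨hV, (prod_mono_right hi).trans hVU⟩, hy⟩, hxi⟩
    · rintro ⟨i, ⟨V, ⟨-, hV⟩, hy⟩, hx⟩
      exact hV ⟨hy, hx⟩
  | compl B _ ih =>
    obtain ⟨E, hE, h⟩ := ih
    -- Over each `y` these rectangles give the exterior of the open set given by `E`. An open set
    -- together with its exterior is dense, so the exterior agrees with the complement on a comeager
    -- set.
    let E' : ℕ → Set Y := fun j => ⋂ i, ⋂ _ : (b i ∩ b j).Nonempty, (E i)ᶜ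
    have hE' : ∀ j, MeasurableSet (E' j) := fun j =>
      MeasurableSet.iInter fun i => MeasurableSet.iInter fun _ => (hE i).compl
    have hdisj : ∀ y x, (∃ i, y ∈ E i ∧ x ∈ b i) → (∃ j, y ∈ E' j ∧ x ∈ b j) → False := by
      rintro y x ⟨i, hy, hx⟩ ⟨j, hy', hx'⟩
      exact mem_iInter₂.1 hy' i ⟨x, hx, hx'⟩ hy
    have hdense := IsAEComeager.of_dense_section (μ := μ) hbo (fun i => (hE i).union (hE' i))
      (fun y => dense_iff_inter_open.2 fun U hU ⟨x, hx⟩ => by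
        obtain ⟨j, hxj, hj⟩ := hb U hU x hx
        by_cases hy : y ∈ E' j
        · exact ⟨x, hx, j, Or.inr hy, hxj⟩
        · simp only [E', mem_iInter, not_forall, mem_compl_iff, not_not] at hy
          obtain ⟨i, ⟨z, hzi, hzj⟩, hyi⟩ := hy
          exact ⟨z, hj hzj, i, Or.inl hyi, hzi⟩)
    refine ⟨E', hE', (h.inter hdense).mono ?_⟩
    rintro ⟨y, x⟩ ⟨h1, i, h2, hxi⟩
    change ((y, x) ∈ B ↔ ∃ i, y ∈ E i ∧ x ∈ b i) at h1
    change ¬ (y, x) ∈ B ↔ ∃ i, y ∈ E' i ∧ x ∈ b i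
    rw [h1]
    refine ⟨fun hn => h2.elim (fun h2 => absurd ⟨i, h2, hxi⟩ hn) fun h2 => ⟨i, h2, hxi⟩,
      fun h' h'' => hdisj y x h'' h'⟩
  | iUnion B _ _ ih =>
    choose E hE h using ih
    refine ⟨fun i => ⋃ n, E n i, fun i => MeasurableSet.iUnion fun n => hE n i,
      (IsAEComeager.iInter h).mono ?_⟩
    rintro ⟨y, x⟩ hp
    have hp' : ∀ n, (y, x) ∈ B n ↔ ∃ i, y ∈ E n i ∧ x ∈ b i := fun n => mem_iInter.1 hp n
    simp only [mem_ofPred_eq, mem_iUnion, hp']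
    constructor
    · rintro ⟨n, i, hy, hx⟩
      exact ⟨i, ⟨n, hy⟩, hx⟩
    · rintro ⟨i, ⟨n, hy⟩, hx⟩
      exact ⟨n, i, hy, hx⟩

/-- Almost every section of `B` agrees on a comeager set with an open set. If the section is meager,
the Baire category theorem makes that open set empty, so the comeager set of agreement avoids `B`.
-/
theorem IsAEComeager.compl_of_ae_isMeagre [SecondCountableTopology X] [BaireSpace X]
    [SecondCountableTopology Y] [BorelSpace Y] [MeasurableSpace X] [BorelSpace X] (μ : Measure Y)
    [μ.OuterRegular] [IsFiniteMeasure μ] {B : Set (Y × X)} (hB : MeasurableSet B)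
    (h : ∀ᵐ y ∂μ, IsMeagre (Prod.mk y ⁻¹' B)) : IsAEComeager μ Bᶜ := by
  obtain ⟨b, hbo, -, hb⟩ := exists_nat_basis X
  obtain ⟨E, -, hE⟩ := exists_iUnion_prod_agree μ hbo hb hB
  refine hE.mono_ae ?_
  filter_upwards [h, hE.ae_section_mem_residual] with y hy1 hy2 x hx hxB
  obtain ⟨i, hyi, hxi⟩ := (hx : (y, x) ∈ B ↔ ∃ i, y ∈ E i ∧ x ∈ b i).1 hxB
  obtain ⟨z, hzi, hz1, hz2⟩ := (dense_of_mem_residual (inter_mem hy1 hy2)).inter_open_nonempty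
    (b i) (hbo i) ⟨x, hxi⟩
  exact hz1 ((hz2 : (y, z) ∈ B ↔ ∃ i, y ∈ E i ∧ z ∈ b i).2 ⟨i, hyi, hzi⟩)

/-- An open set whose vertical sections are coinitial among the open subsets of `Y × X` almost all
of whose vertical sections are dense. -/
theorem exists_isOpen_vsection_ae_dense (X : Type*) [TopologicalSpace X]
    [SecondCountableTopology X] [SecondCountableTopology Y] [BorelSpace Y] (μ : Measure Y)
    [IsFiniteMeasure μ] :
    ∃ O : Set ((ℕ → ℕ) × (Y × X)), IsOpen O ∧
      (∀ α, ∀ᵐ y ∂μ, Dense (Prod.mk y ⁻¹' vsection O α)) ∧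
      ∀ W, IsOpen W → (∀ᵐ y ∂μ, Dense (Prod.mk y ⁻¹' W)) → ∃ α, vsection O α ⊆ W := by
  obtain ⟨b, hbo, -, hb⟩ := exists_nat_basis X
  -- Almost all sections of `s` are dense iff `T i s` is conull for each nonempty `b i`. Conullity
  -- is split into the conditions `μ (T i s)ᶜ < 1/n`, each of which, by finiteness of `μ`, passes
  -- from an increasing union of open sets to one of its members.
  let T : ℕ → Set (Y × X) → Set Y := fun i s => Prod.fst '' (s ∩ Prod.snd ⁻¹' b i)
  have hTmono : ∀ i s t, s ⊆ t → T i s ⊆ T i t := fun i s t hst =>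
    image_mono (inter_subset_inter_left _ hst)
  have hTo : ∀ i s, IsOpen s → IsOpen (T i s) := fun i s hs =>
    isOpenMap_fst _ (hs.inter ((hbo i).preimage continuous_snd))
  obtain ⟨O, hO, hP, h⟩ := exists_isOpen_vsection_of_upwardClosed (ι := ℕ × ℕ)
    (fun j s => (b j.2).Nonempty → μ (T j.2 s)ᶜ < (j.1 : ℝ≥0∞)⁻¹)
    (fun j ⟨x, hx⟩ => by
      have : T j.2 univ = univ := eq_univ_of_forall fun y => ⟨(y, x), ⟨trivial, hx⟩, rfl⟩
      simp [this])
    (fun j s t hst hs hj => (measure_mono (compl_subset_compl.2 (hTmono _ _ _ hst))).trans_lt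
      (hs hj))
    (fun j s hs hso hsu => by
      by_cases hj : (b j.2).Nonempty
      · have ht := tendsto_measure_iInter_atTop (μ := μ) (s := fun n => (T j.2 (s n))ᶜ)
          (fun n => (hTo _ _ (hso n)).measurableSet.compl.nullMeasurableSet)
          (fun m n hmn => compl_subset_compl.2 (hTmono _ _ _ (hs hmn))) ⟨0, measure_ne_top _ _⟩
        rw [← compl_iUnion, show ⋃ n, T j.2 (s n) = T j.2 (⋃ n, s n) by
          simp only [T, iUnion_inter, image_iUnion]] at ht
        exact (ht.eventually (gt_mem_nhds (hsu hj))).exists.imp fun n hn _ => hn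
      · exact ⟨0, fun h => absurd h hj⟩)
  refine ⟨O, hO, fun α => ?_, fun W hW hd => h W hW fun j ⟨x, hx⟩ => ?_⟩
  · have hnull : ∀ i, ∀ᵐ y ∂μ, (b i).Nonempty → y ∈ T i (vsection O α) := by
      intro i
      by_cases hi : (b i).Nonempty
      · have : μ (T i (vsection O α))ᶜ = 0 :=
          le_antisymm (ge_of_tendsto' ENNReal.tendsto_inv_nat_nhds_zero fun n =>
            (hP α (n, i) hi).le) zero_le
        filter_upwards [measure_eq_zero_iff_ae_notMem.1 this] with y hy _
        exact not_not.1 hy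
      · exact Eventually.of_forall fun y h => absurd h hi
    filter_upwards [eventually_countable_forall.2 hnull] with y hy
    refine dense_iff_inter_open.2 fun U hU ⟨x, hx⟩ => ?_
    obtain ⟨i, hxi, hi⟩ := hb U hU x hx
    obtain ⟨⟨y', z⟩, ⟨hz, hzi⟩, rfl⟩ := hy i ⟨x, hxi⟩
    exact ⟨z, hi hzi, hz⟩
  · have : μ (T j.2 W)ᶜ = 0 := by
      refine measure_eq_zero_iff_ae_notMem.2 ?_
      filter_upwards [hd] with y hy
      obtain ⟨z, hz, hzW⟩ := hy.inter_open_nonempty _ (hbo j.2) ⟨x, hx⟩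
      exact fun h => h ⟨(y, z), ⟨hzW, hz⟩, rfl⟩
    rw [this]
    simp

theorem exists_universal_null_meager (X : Type*) [TopologicalSpace X] [PolishSpace X] {Y : Type*}
    [TopologicalSpace Y] [MetrizableSpace Y] [SecondCountableTopology Y] [MeasurableSpace Y]
    [BorelSpace Y] (μ : Measure Y) [IsFiniteMeasure μ] :
    ∃ U : Set ((ℕ → ℕ) × (Y × X)), IsSigmaZeroThree U ∧
      IsUniversalForIdeal U (fubiniProduct (nullIdeal μ) (meagerIdeal X)) := by
  borelize X
  obtain ⟨O, hO, hOd, hOc⟩ := exists_isOpen_vsection_ae_dense X μ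
  choose W hW hWμ hWc using fun n : ℕ => exists_isOpen_vsection_of_hereditary
    (fun s : Set Y => μ s ≤ (n : ℝ≥0∞)⁻¹) (by simp)
    (fun s t hst ht => (measure_mono hst).trans ht)
    (fun s hs h => le_of_tendsto' (tendsto_measure_iUnion_atTop hs) h)
  have hU := isSigmaZeroThree_codedUnion (Z := Y × X) hO hW continuous_id continuous_fst
  refine ⟨_, hU, ?_, ?_⟩
  · rintro _ ⟨α, rfl⟩
    refine ⟨_, hU.measurableSet_vsection α, Subset.rfl, ?_⟩
    have h1 := eventually_countable_forall.2 fun n => hOd (baireSlice α (2 * n))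
    have hnull : μ (⋂ n, vsection (W n) (baireSlice α (2 * n + 1))) = 0 :=
      le_antisymm (ge_of_tendsto' ENNReal.tendsto_inv_nat_nhds_zero fun n =>
        (measure_mono (iInter_subset _ n)).trans (hWμ n _)) zero_le
    refine measure_eq_zero_iff_ae_notMem.2 ?_
    filter_upwards [h1, measure_eq_zero_iff_ae_notMem.1 hnull] with y hy1 hy2
    refine not_not.2 ?_
    change _ ∈ residual X
    have hmem : ⋂ n, Prod.mk y ⁻¹' vsection O (baireSlice α (2 * n)) ∈ residual X :=
      countable_iInter_mem.2 fun n => residual_of_dense_open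
        ((hO.preimage (Continuous.prodMk_right _)).preimage (Continuous.prodMk_right y)) (hy1 n)
    filter_upwards [hmem] with x hx
    rintro (⟨n, hn⟩ | h)
    · exact hn (mem_iInter.1 hx n)
    · exact hy2 (mem_iInter.2 h)
  · rintro A ⟨B, hB, hAB, hBn⟩
    have hB' : MeasurableSet B := by rwa [BorelSpace.measurable_eq (α := Y × X)]
    have hBn' : ∀ᵐ y ∂μ, IsMeagre (Prod.mk y ⁻¹' B) := by
      filter_upwards [measure_eq_zero_iff_ae_notMem.1 hBn] with y hy
      exact not_not.1 hy
    obtain ⟨D, hDo, hDd, hD⟩ := IsAEComeager.compl_of_ae_isMeagre μ hB' hBn'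
    -- The null set of exceptional `y`, where the intersection of the `D n` may meet `B`, is
    -- absorbed by the `G_δ` part.
    choose G hNG hG hGμ using fun n : ℕ => exists_isOpen_lt_of_lt (μ := μ)
      {y | ¬ Prod.mk y ⁻¹' (⋂ n, D n) ⊆ Prod.mk y ⁻¹' Bᶜ} (n : ℝ≥0∞)⁻¹ (by
        rw [ae_iff.1 hD]; simp)
    choose γ hγ using fun n => hOc (D n) (hDo n) (hDd n)
    choose δ hδ using fun n => hWc n (G n) (hG n) (hGμ n).le
    obtain ⟨α, hα⟩ := exists_baireSlice_eq fun k => if k % 2 = 0 then γ (k / 2) else δ (k / 2)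
    have hα0 : ∀ n, baireSlice α (2 * n) = γ n := fun n => by simp [hα]
    have hα1 : ∀ n, baireSlice α (2 * n + 1) = δ n := fun n => by
      rw [hα, if_neg (by omega), show (2 * n + 1) / 2 = n by omega]
    refine ⟨_, ⟨α, rfl⟩, ?_⟩
    rintro ⟨y, x⟩ hxy
    by_cases hx : ∀ n, (y, x) ∈ D n
    · refine Or.inr fun n => ?_
      rw [hα1]
      change y ∈ vsection (W n) (δ n)
      rw [hδ n]
      exact hNG n fun hsub => hsub (mem_iInter.2 hx) (hAB hxy)
    · push Not at hx
      obtain ⟨n, hn⟩ := hx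
      refine Or.inl ⟨n, fun h => hn (hγ n ?_)⟩
      rw [hα0] at h
      exact h

end NullMeager

/-- The Fubini products depend on the measure only through its null sets, so this brings Lebesgue
measure within reach of the results for finite measures. -/
theorem nullIdeal_toFinite {Y : Type*} [MeasurableSpace Y] (μ : Measure Y) [SFinite μ] :
    nullIdeal μ.toFinite = nullIdeal μ :=
  ext fun _ => ⟨fun h => absolutelyContinuous_toFinite μ h,
    fun h => toFinite_absolutelyContinuous μ h⟩

theorem isProbabilityMeasure_cantorHaar : IsProbabilityMeasure cantorHaar := by
  unfold cantorHaar
  infer_instance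

theorem mainTheorem5 (X : Type*) [TopologicalSpace X] [PolishSpace X] :
    ((∃ U : Set ((ℕ → ℕ) × (X × ℝ)), IsSigmaZeroThree U ∧
        IsUniversalForIdeal U
          (fubiniProduct (meagerIdeal X) (nullIdeal (volume : Measure ℝ)))) ∧
      (∃ U : Set ((ℕ → ℕ) × (ℝ × X)), IsSigmaZeroThree U ∧
        IsUniversalForIdeal U
          (fubiniProduct (nullIdeal (volume : Measure ℝ)) (meagerIdeal X)))) ∧
    ((∃ U : Set ((ℕ → ℕ) × (X × (ℕ → Bool))), IsSigmaZeroThree U ∧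
        IsUniversalForIdeal U
          (fubiniProduct (meagerIdeal X) (nullIdeal cantorHaar))) ∧
      (∃ U : Set ((ℕ → ℕ) × ((ℕ → Bool) × X)), IsSigmaZeroThree U ∧
        IsUniversalForIdeal U
          (fubiniProduct (nullIdeal cantorHaar) (meagerIdeal X)))) := by
  have := isProbabilityMeasure_cantorHaar
  rw [← nullIdeal_toFinite (volume : Measure ℝ)]
  exact ⟨⟨exists_universal_meager_null X _, exists_universal_null_meager X _⟩,
    exists_universal_meager_null X _, exists_universal_null_meager X _⟩
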